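/- Let $\mathcal A$ be a unital complex $*$-algebra, $\mathcal B\subseteq\mathcal A$ a unital $*$-subalgebra and $E:\mathcal A\to\mathcal B$ a conditional expectation, i.e. a $\mathbb C$-linear map with $E(bab')=bE(a)b'$ for $b,b'\in\mathcal B$, $a\in\mathcal A$, and $E(1)=1$. Subalgebras $C_1,C_2$ of $\mathcal A$ are called free with respect to a linear map $F:\mathcal A\to\mathcal A$ if $F\big((a_1-F(a_1))\cdots(a_r-F(a_r))\big)=0$ for all $r\ge1$ and all $a_s\in C_{j(s)}$ with $j(1)\ne j(2)\ne\dots\ne j(r)$. Let $\mathcal B\subseteq A_1,A_2\subseteq\mathcal A$ be $*$-subalgebras that are free with respect to $E$. Let $N$ be a natural number, identify $M_N(\mathbb C)\otimes\mathcal A$ with $M_N(\mathcal A)$, and let $\mathbb E=\mathrm{id}\otimes E: M_N(\mathcal A)\to M_N(\mathcal B)$. Let $\mathcal D\subseteq M_N(\mathcal B)$ be a unital $*$-subalgebra and let $x\in M_N(A_1)$, $y\in M_N(A_2)$. For a set $S\subseteq M_N(\mathcal A)$ we say that the $M_N(\mathcal B)$-valued moments of $S$, restricted to arguments in $\mathcal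 D$, remain in $\mathcal D$ if $$\mathbb E(a_1d_1a_2d_2\cdots d_{n-1}a_n)\in\mathcal D\qquad\text{for all } n\ge1,\ a_1,\dots,a_n\in S,\ d_1,\dots,d_{n-1}\in\mathcal D ,$$ and that the $M_N(\mathcal B)$-valued cumulants of $S$, restricted to arguments in $\mathcal D$, remain in $\mathcal D$ if $R_n(a_1,d_1a_2,\dots,d_{n-1}a_n)\in\mathcal D$ for all such $n$, $a_i$, $d_i$, where $(R_n)$ are the operator-valued free cumulants of $\mathbb E$, defined by the moment-cumulant formula $\mathbb E(a_1\cdots a_n)=\sum_{\pi\in NC(n)}R_\pi(a_1,\dots,a_n)$ with $R_\pi$ the multiplicative (nested) extension of $(R_n)$ to non-crossing partitions. Then the following hold. 1. For every set $S\subseteq M_N(\mathcal A)$, the restricted moments of $S$ remain in $\mathcal D$ if and only if the restricted cumulants of $S$ remain in $\mathcal D$. 2. Suppose that the restricted moments of $\{x,x^*\}$ and those of $\{y,y^*\}$ remain in $\mathcal D$ (if $x=x^*$ and $y=y^*$, these are just the moments of $x$ and of $y$). Then $\mathbb E$ maps the $*$-algebra generated by $x$, $y$ and $\mathcal D$ into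 $\mathcal D$, and $x,y$ are $\mathcal D$-free, that is, the $*$-algebras $\langle x,\mathcal D\rangle$ and $\langle y,\mathcal D\rangle$ are free with respect to $\mathbb E$, and also with respect to every conditional expectation $F:M_N(\mathcal A)\to\mathcal D$ with $F\circ\mathbb E=F$. 3. Suppose only that the restricted moments of $x$ and those of $y$ remain in $\mathcal D$. Then the same conclusions hold with $*$-algebras generated replaced by unital algebras generated: $\mathbb E$ maps the unital algebra generated by $x$, $y$ and $\mathcal D$ into $\mathcal D$, and the unital algebras generated by $\{x\}\cup\mathcal D$ and by $\{y\}\cup\mathcal D$ are free with respect to $\mathbb E$ and with respect to every conditional expectation $F:M_N(\mathcal A)\to\mathcal D$ with $F\circ\mathbb E=F$. -/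

import Mathlib

noncomputable section OperatorValuedFreeness

/-- `E` is a conditional expectation of the unital complex `*`-algebra `𝒜` onto its unital
`*`-subalgebra `ℬ` (regarded as a map `𝒜 → 𝒜` with values in `ℬ`), that is, `(𝒜, E)` is a
`ℬ`-probability space. -/
structure IsConditionalExpectation {𝒜 : Type*} [Ring 𝒜] [StarRing 𝒜] [Algebra ℂ 𝒜]
    [StarModule ℂ 𝒜] (E : 𝒜 →ₗ[ℂ] 𝒜) (ℬ : StarSubalgebra ℂ 𝒜) : Prop where
  mem : ∀ a : 𝒜, E a ∈ ℬ
  bimodule : ∀ b ∈ ℬ, ∀ b' ∈ ℬ, ∀ a : 𝒜, E (b * a * b') = b * E a * b'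
  map_one : E 1 = 1

/-- A family of subalgebras `A i` is free with respect to `E` if
`E ((a₁ - E a₁) ⋯ (a_r - E a_r)) = 0` for all `r ≥ 1` and all `a_s ∈ A (j s)` with
`j 1 ≠ j 2 ≠ ⋯ ≠ j r`. A member `(j s, a_s)` of the list `w` records the index and the element. -/
def AlgebrasFree {𝒜 ι : Type*} [Ring 𝒜] [Algebra ℂ 𝒜] (E : 𝒜 →ₗ[ℂ] 𝒜)
    (A : ι → Subalgebra ℂ 𝒜) : Prop :=
  ∀ w : List (ι × 𝒜), w ≠ [] → (w.map Prod.fst).IsChain (· ≠ ·) → (∀ p ∈ w, p.2 ∈ A p.1) →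
    E ((w.map fun p => p.2 - E p.2).prod) = 0

/-- The subsets `S i` of `𝒜` are `𝒟`-free with respect to `E`: the unital `*`-subalgebras
`⟨S i, 𝒟⟩` are free. -/
def FreeOver {𝒜 ι : Type*} [Ring 𝒜] [StarRing 𝒜] [Algebra ℂ 𝒜] [StarModule ℂ 𝒜]
    (E : 𝒜 →ₗ[ℂ] 𝒜) (𝒟 : StarSubalgebra ℂ 𝒜) (S : ι → Set 𝒜) : Prop :=
  AlgebrasFree E fun i => (StarAlgebra.adjoin ℂ (S i ∪ (𝒟 : Set 𝒜))).toSubalgebra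

/-- The variant of `FreeOver` for the unital subalgebras generated by `S i` and `𝒟` without
taking adjoints of the elements of `S i`. -/
def AlgFreeOver {𝒜 ι : Type*} [Ring 𝒜] [StarRing 𝒜] [Algebra ℂ 𝒜] [StarModule ℂ 𝒜]
    (E : 𝒜 →ₗ[ℂ] 𝒜) (𝒟 : StarSubalgebra ℂ 𝒜) (S : ι → Set 𝒜) : Prop :=
  AlgebrasFree E fun i => Algebra.adjoin ℂ (S i ∪ (𝒟 : Set 𝒜))

/-- The `*`-subalgebra `M_N(ℂ) ⊗ S = M_N(S)` of `M_N(𝒜)`: all matrices with entries in `S`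
(the involution of `M_N(𝒜)` is the conjugate transpose). -/
def matrixStarSubalgebra {𝒜 : Type*} [Ring 𝒜] [StarRing 𝒜] [Algebra ℂ 𝒜] [StarModule ℂ 𝒜]
    (N : ℕ) (S : StarSubalgebra ℂ 𝒜) : StarSubalgebra ℂ (Matrix (Fin N) (Fin N) 𝒜) where
  toSubalgebra := S.toSubalgebra.matrix
  star_mem' := by
    intro M hM i j
    exact S.star_mem' (hM j i)

/-- The map `id ⊗ E` on `M_N(ℂ) ⊗ 𝒜 = M_N(𝒜)`: apply `E` to each entry. -/
def matrixExpectation {𝒜 : Type*} [Ring 𝒜] [Algebra ℂ 𝒜] (N : ℕ) (E : 𝒜 →ₗ[ℂ] 𝒜) :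
    Matrix (Fin N) (Fin N) 𝒜 →ₗ[ℂ] Matrix (Fin N) (Fin N) 𝒜 :=
  E.mapMatrix

/-- A partition of `{0, …, n - 1}` is non-crossing if there are no `i < j < k < l` with
`i ∼ k`, `j ∼ l` and `i ≁ j`. -/
def NonCrossing {n : ℕ} (π : Finpartition (Finset.univ : Finset (Fin n))) : Prop :=
  ∀ i j k l : Fin n, i < j → j < k → k < l →
    π.part i = π.part k → π.part j = π.part l → π.part i = π.part j

/-- Nested evaluation of a word `(c₁, a₁), …, (c_n, a_n)` whose labels `c_s` name the blocks of a
non-crossing partition. The word is read from the left; the letters already read whose blocks are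
not yet removed stand in the first argument, last letter first. As soon as the last letter of a
block has been read, that block is an interval `(a_{s+1}, …, a_{s+l})` of what is left of the word;
it is removed and the letter `a_s` just before it is replaced by `a_s * f [a_{s+1}, …, a_{s+l}]`.
If there is no letter before it, then the value of the block is a left factor of the result. -/
def nestedEval {ι 𝒜 : Type*} [DecidableEq ι] [Monoid 𝒜] (f : List 𝒜 → 𝒜) :
    List (ι × 𝒜) → List (ι × 𝒜) → 𝒜
  | _, [] => 1
  | st, (c, a) :: w =>
    if c ∈ w.map Prod.fst then nestedEval f ((c, a) :: st) w
    else
      match st.dropWhile (fun p => decide (p.1 = c)) with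
      | [] =>
        f ((((c, a) :: st).takeWhile fun p => decide (p.1 = c)).reverse.map Prod.snd) *
          nestedEval f [] w
      | (c', a') :: st' =>
        nestedEval f
          ((c', a' *
            f ((((c, a) :: st).takeWhile fun p => decide (p.1 = c)).reverse.map Prod.snd)) :: st') w

/-- The value `f_π (a₁, …, a_n)` at a non-crossing partition `π` of the multiplicative family
determined by `f`, where `f [a₁, …, a_n]` is the value of the family at the one-block partition. -/
def multiplicativeExtension {𝒜 : Type*} [Monoid 𝒜] (f : List 𝒜 → 𝒜) (l : List 𝒜)
    (π : Finpartition (Finset.univ : Finset (Fin l.length))) : 𝒜 :=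
  nestedEval f [] (List.ofFn fun i : Fin l.length => (π.part i, l.get i))

open Classical in
/-- Auxiliary recursion for `freeCumulant`: the operator-valued free cumulants of order at
most `k`, obtained by solving the moment-cumulant formula
`E (a₁ ⋯ a_n) = ∑ π ∈ NC(n), R_π (a₁, …, a_n)` for the summand of the one-block partition. -/
def freeCumulantUpTo {𝒜 : Type*} [Ring 𝒜] [Algebra ℂ 𝒜] (E : 𝒜 →ₗ[ℂ] 𝒜) :
    ℕ → List 𝒜 → 𝒜
  | 0 => fun _ => 0
  | k + 1 => fun l =>
    E l.prod -
      ∑ π : Finpartition (Finset.univ : Finset (Fin l.length)) with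
        NonCrossing π ∧ 1 < π.parts.card,
        multiplicativeExtension (freeCumulantUpTo E k) l π

/-- The operator-valued free cumulant `R_n (a₁, …, a_n)` with respect to `E`,
for `l = [a₁, …, a_n]`, `n ≥ 1`. -/
def freeCumulant {𝒜 : Type*} [Ring 𝒜] [Algebra ℂ 𝒜] (E : 𝒜 →ₗ[ℂ] 𝒜) (l : List 𝒜) : 𝒜 :=
  freeCumulantUpTo E l.length l

/-- The tuple `(a₁, d₁ a₂, …, d_{n-1} a_n)`, for `a = a₁` and
`w = [(d₁, a₂), …, (d_{n-1}, a_n)]`. -/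
def restrictedTuple {𝒜 : Type*} [Mul 𝒜] (a : 𝒜) (w : List (𝒜 × 𝒜)) : List 𝒜 :=
  a :: w.map fun p => p.1 * p.2

/-- The (joint) moments of the elements of `S` restricted to arguments in `𝒟` remain in `𝒟`:
`E (a₁ d₁ a₂ ⋯ d_{n-1} a_n) ∈ 𝒟` for all `n ≥ 1`, `a₁, …, a_n ∈ S` and `d₁, …, d_{n-1} ∈ 𝒟`. -/
def MomentsRemainIn {𝒜 : Type*} [Ring 𝒜] [StarRing 𝒜] [Algebra ℂ 𝒜] [StarModule ℂ 𝒜]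
    (E : 𝒜 →ₗ[ℂ] 𝒜) (𝒟 : StarSubalgebra ℂ 𝒜) (S : Set 𝒜) : Prop :=
  ∀ a ∈ S, ∀ w : List (𝒜 × 𝒜), (∀ p ∈ w, p.1 ∈ 𝒟 ∧ p.2 ∈ S) →
    E (restrictedTuple a w).prod ∈ 𝒟

/-- The (joint) free cumulants of the elements of `S` restricted to arguments in `𝒟` remain
in `𝒟`: `R_n (a₁, d₁ a₂, …, d_{n-1} a_n) ∈ 𝒟` for all `n ≥ 1`, `a₁, …, a_n ∈ S` and
`d₁, …, d_{n-1} ∈ 𝒟`. -/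
def CumulantsRemainIn {𝒜 : Type*} [Ring 𝒜] [StarRing 𝒜] [Algebra ℂ 𝒜] [StarModule ℂ 𝒜]
    (E : 𝒜 →ₗ[ℂ] 𝒜) (𝒟 : StarSubalgebra ℂ 𝒜) (S : Set 𝒜) : Prop :=
  ∀ a ∈ S, ∀ w : List (𝒜 × 𝒜), (∀ p ∈ w, p.1 ∈ 𝒟 ∧ p.2 ∈ S) →
    freeCumulant E (restrictedTuple a w) ∈ 𝒟

end OperatorValuedFreeness

/-! Each entry of a product of centred matrices is a sum of products of centred entries with the
same labels, so freeness of `A₁`, `A₂` passes to the matrix algebras (`AlgebrasFree.matrix`). From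
there on the matrix structure plays almost no role.

Moments versus cumulants: in `R_π` the value of an inner block multiplies the preceding letter from
the right, so letters in `𝒟 S 𝒟` stay there as long as block values lie in `𝒟` (`nestedEval_mem`). A
moment differs from its one-block cumulant by terms with at least two blocks, all of them shorter
than the word. Induction on the length gives both directions.

Freeness: with respect to the expectation it is inherited from the larger algebras. Restricted
moments in `𝒟` make the expectation send each algebra generated by `S i` and `𝒟` into `𝒟`
(`MomentsRemainIn.map_adjoin_mem`). Hence centring does not leave these algebras, and everything
they generate together lies in `𝒟` plus the span of alternating centred products, which the
expectation kills (`AlgebrasFree.map_adjoin_mem`). On each algebra `F a = F (E a) = E a`, so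
freeness holds for `F` too. -/

open Matrix in
/-- Applying a conditional expectation entrywise gives a conditional expectation. -/
theorem IsConditionalExpectation.matrixExpectation {𝒜 : Type*} [Ring 𝒜] [StarRing 𝒜] [Algebra ℂ 𝒜]
    [StarModule ℂ 𝒜] {E : 𝒜 →ₗ[ℂ] 𝒜} {ℬ : StarSubalgebra ℂ 𝒜}
    (hE : IsConditionalExpectation E ℬ) (N : ℕ) :
    IsConditionalExpectation (matrixExpectation N E) (matrixStarSubalgebra N ℬ) where
  mem a i j := hE.mem (a i j)
  bimodule b hb b' hb' a := by
    ext i j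
    have hb : ∀ i j, b i j ∈ ℬ := hb
    have hb' : ∀ i j, b' i j ∈ ℬ := hb'
    simp only [_root_.matrixExpectation, LinearMap.mapMatrix_apply, map_apply, mul_apply,
      Finset.sum_mul, map_sum]
    exact Finset.sum_congr rfl fun k _ => Finset.sum_congr rfl fun l _ =>
      hE.bimodule _ (hb _ _) _ (hb' _ _) _
  map_one := by
    ext i j
    by_cases h : i = j
    · subst h; simp [_root_.matrixExpectation, hE.map_one]
    · simp [_root_.matrixExpectation, h]

theorem IsConditionalExpectation.apply_of_mem {𝒜 : Type*} [Ring 𝒜] [StarRing 𝒜] [Algebra ℂ 𝒜]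
    [StarModule ℂ 𝒜] {E : 𝒜 →ₗ[ℂ] 𝒜} {ℬ : StarSubalgebra ℂ 𝒜}
    (hE : IsConditionalExpectation E ℬ) {b : 𝒜} (hb : b ∈ ℬ) : E b = b := by
  simpa [hE.map_one] using hE.bimodule b hb 1 (one_mem _) 1

theorem IsConditionalExpectation.map_mul_left {𝒜 : Type*} [Ring 𝒜] [StarRing 𝒜] [Algebra ℂ 𝒜]
    [StarModule ℂ 𝒜] {E : 𝒜 →ₗ[ℂ] 𝒜} {ℬ : StarSubalgebra ℂ 𝒜}
    (hE : IsConditionalExpectation E ℬ) {b : 𝒜} (hb : b ∈ ℬ) (a : 𝒜) : E (b * a) = b * E a := by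
  simpa using hE.bimodule b hb 1 (one_mem _) a

/-! ### Restricted moments and restricted cumulants -/

/-- The elements `d * a * d'` with `a ∈ S` and `d, d' ∈ 𝒟`. -/
def bimoduleLetters {𝒜 : Type*} [Ring 𝒜] [Algebra ℂ 𝒜] (𝒟 : Subalgebra ℂ 𝒜) (S : Set 𝒜) : Set 𝒜 :=
  {g | ∃ d ∈ 𝒟, ∃ a ∈ S, ∃ d' ∈ 𝒟, g = d * a * d'}

/-- This is the closure property needed when the value of a removed block is attached to the letter
before it. -/
theorem mul_mem_bimoduleLetters {𝒜 : Type*} [Ring 𝒜] [Algebra ℂ 𝒜] {𝒟 : Subalgebra ℂ 𝒜} {S : Set 𝒜}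
    {g b : 𝒜} (hg : g ∈ bimoduleLetters 𝒟 S) (hb : b ∈ 𝒟) : g * b ∈ bimoduleLetters 𝒟 S := by
  obtain ⟨d, hd, a, ha, d', hd', rfl⟩ := hg
  exact ⟨d, hd, a, ha, d' * b, mul_mem hd' hb, by simp only [mul_assoc]⟩

/-- If `f` maps words of length at most `k` in the letters `G` into `𝒟`, and `G` is a right
`𝒟`-module, then nested evaluations of words in which each label occurs at most `k` times lie
in `𝒟`. -/
theorem nestedEval_mem {ι 𝒜 : Type*} [DecidableEq ι] [Ring 𝒜] [Algebra ℂ 𝒜] {𝒟 : Subalgebra ℂ 𝒜}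
    {G : Set 𝒜} (hG : ∀ g ∈ G, ∀ d ∈ 𝒟, g * d ∈ G) {f : List 𝒜 → 𝒜} {k : ℕ}
    (hf : ∀ l : List 𝒜, (∀ g ∈ l, g ∈ G) → l.length ≤ k → f l ∈ 𝒟) (w : List (ι × 𝒜)) :
    ∀ st : List (ι × 𝒜), (∀ p ∈ st, p.2 ∈ G) → (∀ p ∈ w, p.2 ∈ G) →
      (∀ c, (st.map Prod.fst).count c + (w.map Prod.fst).count c ≤ k) →
      nestedEval f st w ∈ 𝒟 := by
  induction w with
  | nil => intro st _ _ _; simp [nestedEval]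
  | cons p w ih =>
    obtain ⟨c, a⟩ := p
    intro st hst hw hk
    have ha : a ∈ G := hw (c, a) (by simp)
    have hw' : ∀ p ∈ w, p.2 ∈ G := fun p hp => hw p (by simp [hp])
    have hcons : ∀ p ∈ (c, a) :: st, p.2 ∈ G := by
      intro p hp
      rcases List.mem_cons.1 hp with rfl | hp
      · exact ha
      · exact hst p hp
    have hblock : f ((((c, a) :: st).takeWhile fun p => decide (p.1 = c)).reverse.map
        Prod.snd) ∈ 𝒟 := by
      apply hf
      · intro g hg
        simp only [List.map_reverse, List.mem_reverse, List.mem_map] at hg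
        obtain ⟨p, hp, rfl⟩ := hg
        exact hcons p ((List.takeWhile_sublist _).subset hp)
      -- All letters of the removed block carry the label `c`, so the block is no longer than the
      -- number of occurrences of `c`.
      · have hlen : (((c, a) :: st).takeWhile fun p => decide (p.1 = c)).length ≤
            (((c, a) :: st).map Prod.fst).count c := by
          have h1 := ((List.takeWhile_sublist (l := (c, a) :: st)
            fun p => decide (p.1 = c)).map Prod.fst).count_le c
          refine le_trans (le_of_eq ?_) h1
          rw [List.count_eq_length.2, List.length_map]
          intro b hb
          obtain ⟨p, hp, rfl⟩ := List.mem_map.1 hb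
          have hpc := List.mem_takeWhile_imp (p := fun p : ι × 𝒜 => decide (p.1 = c)) hp
          exact (of_decide_eq_true hpc).symm
        have := hk c
        simp only [List.length_map, List.length_reverse]
        simp only [List.map_cons, List.count_cons_self] at this hlen
        omega
    have hcount : ∀ e, (w.map Prod.fst).count e ≤ ((((c, a) :: w)).map Prod.fst).count e :=
      fun e => by rw [List.map_cons]; exact List.count_le_count_cons
    unfold nestedEval
    split_ifs with hc
    · refine ih _ hcons hw' fun e => ?_
      have := hk e
      simp only [List.map_cons, List.count_cons] at this ⊢
      omega
    · have hdrop := (List.dropWhile_sublist (l := st) fun p => decide (p.1 = c))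
      split
      · refine mul_mem hblock (ih _ (by simp) hw' fun e => ?_)
        have := hk e
        have := hcount e
        simp only [List.map_nil, List.count_nil]
        omega
      · rename_i c' a' st' heq
        rw [heq] at hdrop
        refine ih _ ?_ hw' fun e => ?_
        · intro p hp
          rcases List.mem_cons.1 hp with rfl | hp
          · exact hG _ (hst (c', a') (hdrop.subset (by simp))) _ hblock
          · exact hst p (hdrop.subset (by simp [hp]))
        · have h1 := hk e
          have h2 := hcount e
          have h3 := (hdrop.map Prod.fst).count_le e
          simp only [List.map_cons] at h1 h2 h3 ⊢
          omega

/-- Blocks of a partition of `n` points with at least two blocks have at most `n - 1` points. -/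
theorem count_part_lt {n : ℕ} (π : Finpartition (Finset.univ : Finset (Fin n)))
    (hπ : 1 < π.parts.card) (c : Finset (Fin n)) : (List.ofFn π.part).count c < n := by
  by_contra h
  have hlen : (List.ofFn π.part).length = n := by simp
  have hc : (List.ofFn π.part).count c = (List.ofFn π.part).length :=
    le_antisymm List.count_le_length (by omega)
  rw [List.count_eq_length] at hc
  have hsub : π.parts ⊆ {c} := by
    intro p hp
    obtain ⟨i, hi⟩ := π.nonempty_of_mem_parts hp
    rw [Finset.mem_singleton, hc (π.part i) (List.mem_ofFn.2 ⟨i, rfl⟩)]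
    exact (π.part_eq_of_mem hp hi).symm
  have := Finset.card_le_card hsub
  simp at this
  omega

/-- With at least two blocks, every block is strictly shorter than `l`, so the values of `f` on
words of length at most `k` suffice. -/
theorem multiplicativeExtension_mem {𝒜 : Type*} [Ring 𝒜] [Algebra ℂ 𝒜] {𝒟 : Subalgebra ℂ 𝒜}
    {G : Set 𝒜} (hG : ∀ g ∈ G, ∀ d ∈ 𝒟, g * d ∈ G) {f : List 𝒜 → 𝒜} {k : ℕ} {l : List 𝒜}
    (hf : ∀ l' : List 𝒜, (∀ g ∈ l', g ∈ G) → l'.length ≤ k → l'.length ≤ l.length → f l' ∈ 𝒟)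
    (hl : ∀ g ∈ l, g ∈ G) (hk : l.length ≤ k + 1)
    (π : Finpartition (Finset.univ : Finset (Fin l.length))) (hπ : 1 < π.parts.card) :
    multiplicativeExtension f l π ∈ 𝒟 := by
  refine nestedEval_mem (k := min k l.length) hG
    (fun l' h h' => hf l' h (by omega) (by omega)) _ _ (by simp) ?_ ?_
  · intro p hp
    obtain ⟨i, rfl⟩ := List.mem_ofFn.1 hp
    exact hl _ (List.get_mem _ _)
  · intro c
    have h := count_part_lt π hπ c
    have h2 : (List.ofFn fun i : Fin l.length => (π.part i, l.get i)).map Prod.fst =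
        List.ofFn π.part := by
      rw [List.map_ofFn]; rfl
    rw [h2, List.map_nil, List.count_nil]
    omega

/-- The recursion depth `k` drops in the induction while the range `n` of controlled moments stays
fixed, hence two separate bounds. -/
theorem freeCumulantUpTo_mem {𝒜 : Type*} [Ring 𝒜] [Algebra ℂ 𝒜] {E : 𝒜 →ₗ[ℂ] 𝒜}
    {𝒟 : Subalgebra ℂ 𝒜} {G : Set 𝒜} (hG : ∀ g ∈ G, ∀ d ∈ 𝒟, g * d ∈ G) {n : ℕ}
    (hE : ∀ l : List 𝒜, (∀ g ∈ l, g ∈ G) → l.length ≤ n → E l.prod ∈ 𝒟) (k : ℕ) :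
    ∀ l : List 𝒜, (∀ g ∈ l, g ∈ G) → l.length ≤ k → l.length ≤ n →
      freeCumulantUpTo E k l ∈ 𝒟 := by
  induction k with
  | zero => intro l _ _ _; exact zero_mem 𝒟
  | succ k ih =>
    intro l hl hk hn
    refine sub_mem (hE l hl hn) (sum_mem fun π hπ => ?_)
    simp only [Finset.mem_filter] at hπ
    exact multiplicativeExtension_mem hG (fun l' h h' h'' => ih l' h h' (h''.trans hn)) hl hk π
      hπ.2.2

/-- Restricted moments determine the expectations of all words in `𝒟 S 𝒟`. -/
theorem map_prod_mem_of_restricted {𝒜 : Type*} [Ring 𝒜] [StarRing 𝒜] [Algebra ℂ 𝒜]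
    [StarModule ℂ 𝒜] {E : 𝒜 →ₗ[ℂ] 𝒜} {ℬ 𝒟 : StarSubalgebra ℂ 𝒜}
    (hE : IsConditionalExpectation E ℬ) (h𝒟 : 𝒟 ≤ ℬ) {S : Set 𝒜} {n : ℕ}
    (h : ∀ a ∈ S, ∀ w : List (𝒜 × 𝒜), (∀ p ∈ w, p.1 ∈ 𝒟 ∧ p.2 ∈ S) → w.length + 1 ≤ n →
      E (restrictedTuple a w).prod ∈ 𝒟)
    (l : List 𝒜) (hl : ∀ g ∈ l, g ∈ bimoduleLetters 𝒟.toSubalgebra S) (hn : l.length ≤ n) :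
    E l.prod ∈ 𝒟 := by
  -- Each right factor from `𝒟` is moved into the left factor of the next letter; only the last one,
  -- `d'`, remains.
  have key : ∀ l : List 𝒜, (∀ g ∈ l, g ∈ bimoduleLetters 𝒟.toSubalgebra S) → ∀ d ∈ 𝒟,
      ∃ w : List (𝒜 × 𝒜), (∀ p ∈ w, p.1 ∈ 𝒟 ∧ p.2 ∈ S) ∧ w.length = l.length ∧
        ∃ d' ∈ 𝒟, d * l.prod = (w.map fun p => p.1 * p.2).prod * d' := by
    intro l
    induction l with
    | nil => intro _ d hd; exact ⟨[], by simp, rfl, d, hd, by simp⟩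
    | cons g l ih =>
      intro hl d hd
      obtain ⟨d₁, hd₁, a, ha, d₂, hd₂, rfl⟩ := hl g (by simp)
      obtain ⟨w, hw, hlen, d', hd', h⟩ := ih (fun g hg => hl g (by simp [hg])) d₂ hd₂
      refine ⟨(d * d₁, a) :: w, ?_, by simp [hlen], d', hd', ?_⟩
      · intro p hp
        rcases List.mem_cons.1 hp with rfl | hp
        · exact ⟨mul_mem hd hd₁, ha⟩
        · exact hw p hp
      · simp only [List.prod_cons, List.map_cons, mul_assoc] at h ⊢
        rw [h]
  cases l with
  | nil => simp [hE.map_one]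
  | cons g l =>
    obtain ⟨d₁, hd₁, a, ha, d₂, hd₂, rfl⟩ := hl g (by simp)
    obtain ⟨w, hw, hlen, d', hd', hprod⟩ := key l (fun g hg => hl g (by simp [hg])) d₂ hd₂
    have : (d₁ * a * d₂ :: l).prod = d₁ * (restrictedTuple a w).prod * d' := by
      simp only [restrictedTuple, List.prod_cons, mul_assoc, hprod]
    rw [this, hE.bimodule _ (h𝒟 hd₁) _ (h𝒟 hd')]
    refine mul_mem (mul_mem hd₁ (h a ha w hw ?_)) hd'
    simpa [hlen] using hn

theorem restrictedTuple_mem_bimoduleLetters {𝒜 : Type*} [Ring 𝒜] [StarRing 𝒜] [Algebra ℂ 𝒜]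
    [StarModule ℂ 𝒜] {𝒟 : StarSubalgebra ℂ 𝒜} {S : Set 𝒜} {a : 𝒜} (ha : a ∈ S)
    {w : List (𝒜 × 𝒜)} (hw : ∀ p ∈ w, p.1 ∈ 𝒟 ∧ p.2 ∈ S) :
    ∀ g ∈ restrictedTuple a w, g ∈ bimoduleLetters 𝒟.toSubalgebra S := by
  intro g hg
  rcases List.mem_cons.1 hg with rfl | hg
  · exact ⟨1, one_mem _, g, ha, 1, one_mem _, by simp⟩
  · obtain ⟨p, hp, rfl⟩ := List.mem_map.1 hg
    exact ⟨p.1, (hw p hp).1, p.2, (hw p hp).2, 1, one_mem _, by simp⟩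

/-- Restricted moments remain in `𝒟` if and only if restricted cumulants do. -/
theorem momentsRemainIn_iff_cumulantsRemainIn {𝒜 : Type*} [Ring 𝒜] [StarRing 𝒜] [Algebra ℂ 𝒜]
    [StarModule ℂ 𝒜] {E : 𝒜 →ₗ[ℂ] 𝒜} {ℬ 𝒟 : StarSubalgebra ℂ 𝒜}
    (hE : IsConditionalExpectation E ℬ) (h𝒟 : 𝒟 ≤ ℬ) (S : Set 𝒜) :
    MomentsRemainIn E 𝒟 S ↔ CumulantsRemainIn E 𝒟 S := by
  have hG : ∀ g ∈ bimoduleLetters 𝒟.toSubalgebra S, ∀ d ∈ 𝒟.toSubalgebra,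
      g * d ∈ bimoduleLetters 𝒟.toSubalgebra S := fun g hg d hd => mul_mem_bimoduleLetters hg hd
  constructor
  · intro h a ha w hw
    exact freeCumulantUpTo_mem (𝒟 := 𝒟.toSubalgebra) hG (n := (restrictedTuple a w).length)
      (map_prod_mem_of_restricted hE h𝒟 fun a ha w hw _ => h a ha w hw) _ _
      (restrictedTuple_mem_bimoduleLetters ha hw) le_rfl le_rfl
  · intro h
    have main : ∀ n : ℕ, ∀ a ∈ S, ∀ w : List (𝒜 × 𝒜), (∀ p ∈ w, p.1 ∈ 𝒟 ∧ p.2 ∈ S) →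
        w.length + 1 ≤ n → E (restrictedTuple a w).prod ∈ 𝒟 := by
      intro n
      induction n with
      | zero => intro a _ w _ hn; omega
      | succ n ih =>
        intro a ha w hw hn
        have hG' := restrictedTuple_mem_bimoduleLetters ha hw
        have hlen : (restrictedTuple a w).length = w.length + 1 := by simp [restrictedTuple]
        have hR := h a ha w hw
        rw [freeCumulant, hlen, freeCumulantUpTo] at hR
        -- The moment is its cumulant plus the terms with several blocks; these involve only shorter
        -- moments, covered by `ih`.
        rw [← sub_add_cancel (E (restrictedTuple a w).prod)]
        refine add_mem hR (sum_mem fun π hπ => ?_)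
        simp only [Finset.mem_filter] at hπ
        refine multiplicativeExtension_mem (𝒟 := 𝒟.toSubalgebra) hG (k := w.length) ?_ hG' hlen.le π
          hπ.2.2
        intro l' hl' hk _
        exact freeCumulantUpTo_mem (𝒟 := 𝒟.toSubalgebra) hG (n := n)
          (map_prod_mem_of_restricted hE h𝒟 ih) _ _ hl' hk (by omega)
    exact fun a ha w hw => main _ a ha w hw le_rfl

/-! ### Freeness -/

theorem AlgebrasFree.mono {𝒜 ι : Type*} [Ring 𝒜] [Algebra ℂ 𝒜] {E : 𝒜 →ₗ[ℂ] 𝒜}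
    {A C : ι → Subalgebra ℂ 𝒜} (h : AlgebrasFree E A) (hC : ∀ i, C i ≤ A i) : AlgebrasFree E C :=
  fun w hw hchain hmem => h w hw hchain fun p hp => hC _ (hmem p hp)

open Matrix in
/-- Matrix algebras over free algebras are free with respect to the entrywise expectation. -/
theorem AlgebrasFree.matrix {𝒜 ι : Type*} [Ring 𝒜] [Algebra ℂ 𝒜] {E : 𝒜 →ₗ[ℂ] 𝒜}
    {A : ι → Subalgebra ℂ 𝒜} (h : AlgebrasFree E A) (N : ℕ) :
    AlgebrasFree (matrixExpectation N E) fun i => (A i).matrix (n := Fin N) := by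
  -- A general `φ` lets the induction absorb the entries of the factors already expanded, as left
  -- multiplications.
  have key : ∀ w : List (ι × Matrix (Fin N) (Fin N) 𝒜),
      (∀ p ∈ w, p.2 ∈ (A p.1).matrix (n := Fin N)) → ∀ (φ : 𝒜 →ₗ[ℂ] 𝒜),
      (∀ v : List (ι × 𝒜), v.map Prod.fst = w.map Prod.fst → (∀ p ∈ v, p.2 ∈ A p.1) →
        φ (v.map fun p => p.2 - E p.2).prod = 0) →
      ∀ i j, φ ((w.map fun p => p.2 - matrixExpectation N E p.2).prod i j) = 0 := by
    intro w
    induction w with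
    | nil =>
      intro _ φ hφ i j
      have h1 : φ 1 = 0 := by simpa using hφ [] rfl (by simp)
      by_cases hij : i = j <;> simp [hij, h1]
    | cons p w ih =>
      intro hw φ hφ i j
      rw [List.map_cons, List.prod_cons, mul_apply, map_sum]
      refine Finset.sum_eq_zero fun k _ => ?_
      refine ih (fun q hq => hw q (by simp [hq]))
        (φ ∘ₗ LinearMap.mulLeft ℂ ((p.2 - matrixExpectation N E p.2) i k)) (fun v hv hvA => ?_) k j
      have := hφ ((p.1, p.2 i k) :: v) (by simp [hv]) (by
        intro q hq
        rcases List.mem_cons.1 hq with rfl | hq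
        · exact hw p (by simp) i k
        · exact hvA q hq)
      simpa [matrixExpectation] using this
  intro w hw hchain hmem
  ext i j
  refine key w hmem E (fun v hv hvA => h v ?_ (hv ▸ hchain) hvA) i j
  rintro rfl
  exact hw (by simpa using hv.symm)

/-- Products `a₁ ⋯ a_r`, `r ≥ 1`, with `a_s ∈ A (j s)`, `E a_s = 0` and `j 1 ≠ j 2 ≠ ⋯ ≠ j r`. -/
def alternatingProducts {𝒜 ι : Type*} [Ring 𝒜] [Algebra ℂ 𝒜] (E : 𝒜 →ₗ[ℂ] 𝒜)
    (A : ι → Subalgebra ℂ 𝒜) : Set 𝒜 :=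
  {a | ∃ w : List (ι × 𝒜), w ≠ [] ∧ (w.map Prod.fst).IsChain (· ≠ ·) ∧
    (∀ p ∈ w, p.2 ∈ A p.1 ∧ E p.2 = 0) ∧ a = (w.map Prod.snd).prod}

theorem AlgebrasFree.map_alternatingProducts {𝒜 ι : Type*} [Ring 𝒜] [Algebra ℂ 𝒜]
    {E : 𝒜 →ₗ[ℂ] 𝒜} {A : ι → Subalgebra ℂ 𝒜} (h : AlgebrasFree E A) {a : 𝒜}
    (ha : a ∈ alternatingProducts E A) : E a = 0 := by
  obtain ⟨w, hw, hchain, hmem, rfl⟩ := ha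
  rw [← h w hw hchain fun p hp => (hmem p hp).1]
  congr 2
  exact List.map_congr_left fun p hp => by simp [(hmem p hp).2]

theorem cons_mem_alternatingProducts {𝒜 ι : Type*} [Ring 𝒜] [Algebra ℂ 𝒜] {E : 𝒜 →ₗ[ℂ] 𝒜}
    {A : ι → Subalgebra ℂ 𝒜} {i : ι} {c : 𝒜} {w : List (ι × 𝒜)} (hc : c ∈ A i) (hEc : E c = 0)
    (hchain : (i :: w.map Prod.fst).IsChain (· ≠ ·)) (hw : ∀ p ∈ w, p.2 ∈ A p.1 ∧ E p.2 = 0) :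
    c * (w.map Prod.snd).prod ∈ alternatingProducts E A := by
  refine ⟨(i, c) :: w, by simp, by simpa using hchain, ?_, by simp⟩
  intro p hp
  rcases List.mem_cons.1 hp with rfl | hp
  · exact ⟨hc, hEc⟩
  · exact hw p hp

/-- If `E` maps each of the free algebras `A i ⊇ 𝒟` into `𝒟`, then it maps the algebra generated
by all of them into `𝒟`. -/
theorem AlgebrasFree.map_adjoin_mem {𝒜 ι : Type*} [Ring 𝒜] [StarRing 𝒜] [Algebra ℂ 𝒜]
    [StarModule ℂ 𝒜] {E : 𝒜 →ₗ[ℂ] 𝒜} {ℬ 𝒟 : StarSubalgebra ℂ 𝒜}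
    (hE : IsConditionalExpectation E ℬ) (h𝒟 : 𝒟 ≤ ℬ) {A : ι → Subalgebra ℂ 𝒜}
    (h : AlgebrasFree E A) (hA : ∀ i, 𝒟.toSubalgebra ≤ A i) (hEA : ∀ i, ∀ a ∈ A i, E a ∈ 𝒟)
    {c : 𝒜} (hc : c ∈ Algebra.adjoin ℂ (⋃ i, (A i : Set 𝒜))) : E c ∈ 𝒟 := by
  -- `V` contains `1` and is stable under left multiplication by each `A i`, hence contains the
  -- algebra they generate.
  set V : Submodule ℂ 𝒜 :=
    Subalgebra.toSubmodule 𝒟.toSubalgebra ⊔ Submodule.span ℂ (alternatingProducts E A) with hV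
  have hDV : ∀ d ∈ 𝒟, d ∈ V := fun d hd => Submodule.mem_sup_left hd
  have hPV : ∀ a ∈ alternatingProducts E A, a ∈ V :=
    fun a ha => Submodule.mem_sup_right (Submodule.subset_span ha)
  have hcent : ∀ i, ∀ a ∈ A i, a - E a ∈ A i ∧ E (a - E a) = 0 := fun i a ha =>
    ⟨sub_mem ha (hA i (hEA i a ha)),
      by rw [map_sub, hE.apply_of_mem (hE.mem a), sub_self]⟩
  -- The factor `d` is absorbed into the first letter, which stays centred by the module property of
  -- `E`.
  have hD : ∀ d ∈ 𝒟, ∀ w : List (ι × 𝒜), (w.map Prod.fst).IsChain (· ≠ ·) →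
      (∀ p ∈ w, p.2 ∈ A p.1 ∧ E p.2 = 0) → d * (w.map Prod.snd).prod ∈ V := by
    intro d hd w hchain hw
    cases w with
    | nil => simpa using hDV d hd
    | cons p w =>
      have hp := hw p (by simp)
      rw [List.map_cons, List.prod_cons, ← mul_assoc]
      refine hPV _ (cons_mem_alternatingProducts (i := p.1) (mul_mem (hA _ hd) hp.1) ?_
        (by simpa using hchain) fun q hq => hw q (by simp [hq]))
      rw [hE.map_mul_left (h𝒟 hd), hp.2, mul_zero]
  have hsplit : ∀ i, ∀ a ∈ A i, ∀ w : List (ι × 𝒜), (i :: w.map Prod.fst).IsChain (· ≠ ·) →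
      (∀ p ∈ w, p.2 ∈ A p.1 ∧ E p.2 = 0) → a * (w.map Prod.snd).prod ∈ V := by
    intro i a ha w hchain hw
    rw [← sub_add_cancel a (E a), add_mul]
    exact add_mem (hPV _ (cons_mem_alternatingProducts (hcent i a ha).1 (hcent i a ha).2 hchain hw))
      (hD _ (hEA i a ha) w hchain.tail hw)
  -- If `a` and the first letter have the same label, they are merged before centring.
  have hword : ∀ i, ∀ a ∈ A i, ∀ w : List (ι × 𝒜), (w.map Prod.fst).IsChain (· ≠ ·) →
      (∀ p ∈ w, p.2 ∈ A p.1 ∧ E p.2 = 0) → a * (w.map Prod.snd).prod ∈ V := by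
    intro i a ha w hchain hw
    cases w with
    | nil => exact hsplit i a ha [] (by simp) hw
    | cons p w =>
      by_cases hi : i = p.1
      · subst hi
        rw [List.map_cons, List.prod_cons, ← mul_assoc]
        exact hsplit p.1 _ (mul_mem ha (hw p (by simp)).1) w (by simpa using hchain)
          fun q hq => hw q (by simp [hq])
      · refine hsplit i a ha _ ?_ hw
        simp only [List.map_cons, List.isChain_cons_cons] at hchain ⊢
        exact ⟨hi, hchain⟩
  have hmul : ∀ i, ∀ a ∈ A i, ∀ v ∈ V, a * v ∈ V := by
    intro i a ha v hv
    suffices V ≤ V.comap (LinearMap.mulLeft ℂ a) from this hv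
    refine sup_le (fun d hd => ?_) (Submodule.span_le.2 ?_)
    · simpa using hword i (a * d) (mul_mem ha (hA i hd)) [] (by simp) (by simp)
    · rintro _ ⟨w, -, hchain, hw, rfl⟩
      exact hword i a ha w hchain hw
  have hcV : ∀ v ∈ V, c * v ∈ V := by
    induction hc using Algebra.adjoin_induction with
    | mem a ha =>
      obtain ⟨i, hi⟩ := Set.mem_iUnion.1 ha
      exact hmul i a hi
    | algebraMap r =>
      intro v hv
      rw [← Algebra.smul_def]
      exact V.smul_mem r hv
    | add a b _ _ iha ihb => intro v hv; rw [add_mul]; exact add_mem (iha v hv) (ihb v hv)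
    | mul a b _ _ iha ihb => intro v hv; rw [mul_assoc]; exact iha _ (ihb v hv)
  have hEV : V ≤ (Subalgebra.toSubmodule 𝒟.toSubalgebra).comap E := by
    refine sup_le (fun d hd => ?_) (Submodule.span_le.2 fun a ha => ?_)
    · have hd : d ∈ 𝒟 := hd
      change E d ∈ 𝒟
      rwa [hE.apply_of_mem (h𝒟 hd)]
    · change E a ∈ 𝒟
      rw [h.map_alternatingProducts ha]
      exact zero_mem _
  exact hEV (by simpa using hcV 1 (hDV 1 (one_mem _)))

/-- If the restricted moments of `S` remain in `𝒟`, then `E` maps the algebra generated by `S`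
and `𝒟` into `𝒟`. -/
theorem MomentsRemainIn.map_adjoin_mem {𝒜 : Type*} [Ring 𝒜] [StarRing 𝒜] [Algebra ℂ 𝒜]
    [StarModule ℂ 𝒜] {E : 𝒜 →ₗ[ℂ] 𝒜} {ℬ 𝒟 : StarSubalgebra ℂ 𝒜}
    (hE : IsConditionalExpectation E ℬ) (h𝒟 : 𝒟 ≤ ℬ) {S : Set 𝒜} (h : MomentsRemainIn E 𝒟 S)
    {c : 𝒜} (hc : c ∈ Algebra.adjoin ℂ (S ∪ (𝒟 : Set 𝒜))) : E c ∈ 𝒟 := by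
  -- Reading from the right, the leading factor from `𝒟` is swallowed by the next letter from `S` or
  -- multiplied by the next element of `𝒟`.
  have hl : ∀ l : List 𝒜, (∀ g ∈ l, g ∈ S ∪ (𝒟 : Set 𝒜)) →
      ∃ d ∈ 𝒟, ∃ l' : List 𝒜, (∀ g ∈ l', g ∈ bimoduleLetters 𝒟.toSubalgebra S) ∧
        l.prod = d * l'.prod := by
    intro l
    induction l with
    | nil => intro _; exact ⟨1, one_mem _, [], by simp, by simp⟩
    | cons g l ih =>
      intro hl
      obtain ⟨d, hd, l', hl', hprod⟩ := ih fun g hg => hl g (by simp [hg])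
      rcases hl g (by simp) with hg | hg
      · refine ⟨1, one_mem _, (1 * g * d) :: l', ?_, by simp [hprod, mul_assoc]⟩
        intro q hq
        rcases List.mem_cons.1 hq with rfl | hq
        · exact ⟨1, one_mem _, g, hg, d, hd, rfl⟩
        · exact hl' q hq
      · exact ⟨g * d, mul_mem hg hd, l', hl', by simp [hprod, mul_assoc]⟩
  rw [← Subalgebra.mem_toSubmodule, Algebra.adjoin_eq_span] at hc
  suffices Submodule.span ℂ (Submonoid.closure (S ∪ (𝒟 : Set 𝒜)) : Set 𝒜) ≤
    (Subalgebra.toSubmodule 𝒟.toSubalgebra).comap E from this hc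
  refine Submodule.span_le.2 fun a ha => ?_
  obtain ⟨l, hlS, rfl⟩ := Submonoid.exists_list_of_mem_closure ha
  obtain ⟨d, hd, l', hl', hprod⟩ := hl l hlS
  change E l.prod ∈ 𝒟
  rw [hprod, hE.map_mul_left (h𝒟 hd)]
  exact mul_mem hd (map_prod_mem_of_restricted hE h𝒟 (fun a ha w hw _ => h a ha w hw) l' hl' le_rfl)

/-- Freeness passes to conditional expectations that factor through `E`. -/
theorem AlgebrasFree.of_comp_eq {𝒜 ι : Type*} [Ring 𝒜] [StarRing 𝒜] [Algebra ℂ 𝒜]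
    [StarModule ℂ 𝒜] {E F : 𝒜 →ₗ[ℂ] 𝒜} {𝒟 : StarSubalgebra ℂ 𝒜} {A : ι → Subalgebra ℂ 𝒜}
    (h : AlgebrasFree E A) (hEA : ∀ i, ∀ a ∈ A i, E a ∈ 𝒟)
    (hF : IsConditionalExpectation F 𝒟) (hFE : F ∘ₗ E = F) : AlgebrasFree F A := by
  have hFE' : ∀ a, F (E a) = F a := fun a => LinearMap.congr_fun hFE a
  intro w hw hchain hmem
  have : (w.map fun p => p.2 - F p.2) = w.map fun p => p.2 - E p.2 :=
    List.map_congr_left fun p hp => by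
      rw [← hFE' p.2, hF.apply_of_mem (hEA _ _ (hmem p hp))]
  rw [this, ← hFE', h w hw hchain hmem, map_zero]

/-- Sets in free algebras over `ℬ` whose restricted moments remain in `𝒟 ⊆ ℬ` are free
over `𝒟`. -/
theorem AlgebrasFree.of_momentsRemainIn {𝒜 ι : Type*} [Ring 𝒜] [StarRing 𝒜] [Algebra ℂ 𝒜]
    [StarModule ℂ 𝒜] {E : 𝒜 →ₗ[ℂ] 𝒜} {ℬ 𝒟 : StarSubalgebra ℂ 𝒜}
    (hE : IsConditionalExpectation E ℬ) (h𝒟 : 𝒟 ≤ ℬ) {A : ι → Subalgebra ℂ 𝒜}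
    (h : AlgebrasFree E A) (hA : ∀ i, ℬ.toSubalgebra ≤ A i) {S : ι → Set 𝒜}
    (hS : ∀ i, S i ⊆ A i) (hM : ∀ i, MomentsRemainIn E 𝒟 (S i)) {T : Set 𝒜}
    (hT : T ⊆ ⋃ i, (Algebra.adjoin ℂ (S i ∪ (𝒟 : Set 𝒜)) : Set 𝒜)) :
    (∀ c ∈ Algebra.adjoin ℂ T, E c ∈ 𝒟) ∧
      AlgebrasFree E (fun i => Algebra.adjoin ℂ (S i ∪ (𝒟 : Set 𝒜))) ∧
      ∀ F : 𝒜 →ₗ[ℂ] 𝒜, IsConditionalExpectation F 𝒟 → F ∘ₗ E = F →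
        AlgebrasFree F (fun i => Algebra.adjoin ℂ (S i ∪ (𝒟 : Set 𝒜))) := by
  have hfree : AlgebrasFree E fun i => Algebra.adjoin ℂ (S i ∪ (𝒟 : Set 𝒜)) :=
    h.mono fun i => Algebra.adjoin_le
      (Set.union_subset (hS i) fun d hd => hA i (h𝒟 hd))
  have hEA : ∀ i, ∀ a ∈ Algebra.adjoin ℂ (S i ∪ (𝒟 : Set 𝒜)), E a ∈ 𝒟 :=
    fun i a ha => (hM i).map_adjoin_mem hE h𝒟 ha
  refine ⟨fun c hc => ?_, hfree, fun F hF hFE => hfree.of_comp_eq hEA hF hFE⟩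
  exact hfree.map_adjoin_mem hE h𝒟
    (fun i d hd => Algebra.subset_adjoin (Or.inr hd)) hEA (Algebra.adjoin_mono hT hc)

/-- Since `𝒟` is self-adjoint, only the adjoints of `S` have to be added. This reduces the
`*`-statement to the algebraic one for `{x, star x}` and `{y, star y}`. -/
theorem StarAlgebra.adjoin_union_toSubalgebra {𝒜 : Type*} [Ring 𝒜] [StarRing 𝒜] [Algebra ℂ 𝒜]
    [StarModule ℂ 𝒜] (S : Set 𝒜) (𝒟 : StarSubalgebra ℂ 𝒜) :
    (StarAlgebra.adjoin ℂ (S ∪ (𝒟 : Set 𝒜))).toSubalgebra =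
      Algebra.adjoin ℂ ((S ∪ star S) ∪ (𝒟 : Set 𝒜)) := by
  have h𝒟 : star (𝒟 : Set 𝒜) = 𝒟 := by
    ext d
    exact star_mem_iff (s := 𝒟)
  rw [StarAlgebra.adjoin_toSubalgebra, Set.union_star, h𝒟, Set.union_union_union_comm,
    Set.union_self]

theorem mainTheorem12 {𝒜 : Type*} [Ring 𝒜] [StarRing 𝒜] [Algebra ℂ 𝒜] [StarModule ℂ 𝒜]
    (ℬ : StarSubalgebra ℂ 𝒜) (E : 𝒜 →ₗ[ℂ] 𝒜) (hE : IsConditionalExpectation E ℬ)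
    (A₁ A₂ : StarSubalgebra ℂ 𝒜) (hA₁ : ℬ ≤ A₁) (hA₂ : ℬ ≤ A₂)
    (hfree : AlgebrasFree E ![A₁.toSubalgebra, A₂.toSubalgebra])
    (N : ℕ) (𝒟 : StarSubalgebra ℂ (Matrix (Fin N) (Fin N) 𝒜))
    (h𝒟 : 𝒟 ≤ matrixStarSubalgebra N ℬ)
    (x y : Matrix (Fin N) (Fin N) 𝒜)
    (hx : x ∈ matrixStarSubalgebra N A₁) (hy : y ∈ matrixStarSubalgebra N A₂) :
    -- restricted moments remain in `𝒟` if and only if restricted cumulants do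
    (∀ S : Set (Matrix (Fin N) (Fin N) 𝒜),
      MomentsRemainIn (matrixExpectation N E) 𝒟 S ↔
        CumulantsRemainIn (matrixExpectation N E) 𝒟 S) ∧
    -- the `*`-algebraic statement; for self-adjoint `x`, `y` the sets are `{x}` and `{y}`
    (MomentsRemainIn (matrixExpectation N E) 𝒟 {x, star x} →
      MomentsRemainIn (matrixExpectation N E) 𝒟 {y, star y} →
      (∀ c ∈ StarAlgebra.adjoin ℂ ({x, y} ∪ (𝒟 : Set (Matrix (Fin N) (Fin N) 𝒜))),
        matrixExpectation N E c ∈ 𝒟) ∧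
      FreeOver (matrixExpectation N E) 𝒟 ![{x}, {y}] ∧
      ∀ F : Matrix (Fin N) (Fin N) 𝒜 →ₗ[ℂ] Matrix (Fin N) (Fin N) 𝒜,
        IsConditionalExpectation F 𝒟 → F ∘ₗ matrixExpectation N E = F →
        FreeOver F 𝒟 ![{x}, {y}]) ∧
    -- the algebraic statement, which involves only `x` and `y` and not their adjoints
    (MomentsRemainIn (matrixExpectation N E) 𝒟 {x} →
      MomentsRemainIn (matrixExpectation N E) 𝒟 {y} →
      (∀ c ∈ Algebra.adjoin ℂ ({x, y} ∪ (𝒟 : Set (Matrix (Fin N) (Fin N) 𝒜))),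
        matrixExpectation N E c ∈ 𝒟) ∧
      AlgFreeOver (matrixExpectation N E) 𝒟 ![{x}, {y}] ∧
      ∀ F : Matrix (Fin N) (Fin N) 𝒜 →ₗ[ℂ] Matrix (Fin N) (Fin N) 𝒜,
        IsConditionalExpectation F 𝒟 → F ∘ₗ matrixExpectation N E = F →
        AlgFreeOver F 𝒟 ![{x}, {y}]) := by
  have h𝔼 := hE.matrixExpectation N
  have hfreeN := hfree.matrix N
  have hAN : ∀ i, (matrixStarSubalgebra N ℬ).toSubalgebra ≤
      (![A₁.toSubalgebra, A₂.toSubalgebra] i).matrix (n := Fin N) := by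
    refine Fin.forall_fin_two.2 ⟨fun b hb i j => hA₁ (hb i j), fun b hb i j => hA₂ (hb i j)⟩
  refine ⟨momentsRemainIn_iff_cumulantsRemainIn h𝔼 h𝒟, fun hMx hMy => ?_, fun hMx hMy => ?_⟩
  · have hset : ∀ i, (![{x}, {y}] : Fin 2 → Set (Matrix (Fin N) (Fin N) 𝒜)) i ∪
        star ((![{x}, {y}] : Fin 2 → Set (Matrix (Fin N) (Fin N) 𝒜)) i) =
        (![{x, star x}, {y, star y}] : Fin 2 → Set (Matrix (Fin N) (Fin N) 𝒜)) i := by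
      refine Fin.forall_fin_two.2 ⟨?_, ?_⟩ <;> simp [Set.star_singleton, Set.pair_comm]
    have := hfreeN.of_momentsRemainIn h𝔼 h𝒟 hAN (S := ![{x, star x}, {y, star y}])
      (T := ({x, y} ∪ star {x, y}) ∪ (𝒟 : Set (Matrix (Fin N) (Fin N) 𝒜)))
      (Fin.forall_fin_two.2 ⟨by
        rintro _ (rfl | rfl)
        exacts [hx, star_mem (s := matrixStarSubalgebra N A₁) hx], by
        rintro _ (rfl | rfl)
        exacts [hy, star_mem (s := matrixStarSubalgebra N A₂) hy]⟩)
      (Fin.forall_fin_two.2 ⟨hMx, hMy⟩) (by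
        intro a ha
        simp only [Set.mem_iUnion, Fin.exists_fin_two]
        rcases ha with ((rfl | rfl) | ha) | ha
        · exact Or.inl (Algebra.subset_adjoin (by simp))
        · exact Or.inr (Algebra.subset_adjoin (by simp))
        · rcases ha with ha | ha
          · exact Or.inl (Algebra.subset_adjoin (by simp [← ha]))
          · have ha : star a = y := ha
            exact Or.inr (Algebra.subset_adjoin (by simp [← ha]))
        -- Elements of `𝒟` lie in both algebras; the first is an arbitrary choice.
        · exact Or.inl (Algebra.subset_adjoin (Or.inr ha)))
    simp only [FreeOver, StarAlgebra.adjoin_union_toSubalgebra, hset]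
    refine ⟨fun c hc => this.1 c ?_, this.2⟩
    rwa [← StarAlgebra.adjoin_union_toSubalgebra]
  · exact hfreeN.of_momentsRemainIn h𝔼 h𝒟 hAN (S := ![{x}, {y}])
      (Fin.forall_fin_two.2 ⟨by rintro _ rfl; exact hx, by rintro _ rfl; exact hy⟩)
      (Fin.forall_fin_two.2 ⟨hMx, hMy⟩) (by
        intro a ha
        simp only [Set.mem_iUnion, Fin.exists_fin_two]
        rcases ha with (rfl | rfl) | ha
        · exact Or.inl (Algebra.subset_adjoin (by simp))
        · exact Or.inr (Algebra.subset_adjoin (by simp))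
        · exact Or.inl (Algebra.subset_adjoin (Or.inr ha)))
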